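/- Let $\mathcal{T}$ be a commutative semiring (zero $0$, unit $1$) with a symmetry, i.e. a map $a\mapsto\ominus a$ with $\ominus(a\oplus b)=(\ominus a)\oplus(\ominus b)$, $\ominus 0=0$, $\ominus(ab)=a(\ominus b)=(\ominus a)b$ and $\ominus(\ominus a)=a$. Write $a\ominus b:=a\oplus(\ominus b)$, $a^\circ:=a\ominus a$, $\mathcal{T}^\circ:=\{a^\circ : a\in\mathcal{T}\}$, let $\mathcal{T}^*$ be the set of invertible elements and $\mathcal{T}^\vee:=\mathcal{T}^*\cup\{0\}$. Write $a\preceq b$ (equivalently $b\succeq a$) if $b=a\oplus c$ for some $c\in\mathcal{T}$, and $b\succeq^\circ a$ if $b=a\oplus c$ for some $c\in\mathcal{T}^\circ$; $\succeq^\circ$ is applied to matrices entrywise. Assume that $\preceq$ is an order relation on $\mathcal{T}$, that there is a surjective semiring morphism $a\mapsto|a|$ from $\mathcal{T}$ onto an idempotent semifield which is totally ordered by its own relation $\preceq$, and that for all $a,b\in\mathcal{T}$: 1. if $|a|\prec|b|$, then $a\oplus b=b$; 2. if $b\succeq a$, $|a|=|b|$ and $b\in\mathcal{T}^\vee$, then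 $a=b$; 3. $a^\circ\oplus a^\circ=a^\circ$. For a bijection $\sigma:I\to J$ between finite totally ordered sets put $\operatorname{sign}(\sigma)=(\ominus 1)^{|\{(i,j)\in I^2:\ i<j,\ \sigma(i)>\sigma(j)\}|}$. For $A=(a_{i,j})\in\mathcal{T}^{n\times n}$ let $\det(A)=\bigoplus_{\sigma}\operatorname{sign}(\sigma)\bigodot_{i}a_{i,\sigma(i)}$, the sum being over all permutations $\sigma$ of $[n]=\{1,\dots,n\}$; call $A$ nonsingular if $\det(A)\in\mathcal{T}^*$. Let $\operatorname{adj}(A)$ be the $n\times n$ matrix with entries $\operatorname{adj}(A)_{i,j}=(\ominus 1)^{i+j}\det(A_{(j,i)})$, where $A_{(j,i)}$ is $A$ with row $j$ and column $i$ deleted, and, for nonsingular $A$, let $A^\nabla=\operatorname{adj}(A)\det(A)^{-1}$. For $0\le k\le n$ let $A^{\wedge k}$ be the $k$-th compound matrix, indexed by the $k$-element subsets $I,J$ of $[n]$, with entries $A^{\wedge k}_{I,J}=\bigoplus_{\sigma}\operatorname{sign}(\sigma)\bigodot_{i\in I}a_{i,\sigma(i)}$, the sum being over all bijections $\sigma:I\to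 J$. If $A\in\mathcal{T}^{n\times n}$ is nonsingular, then for every $k\in\{0,\dots,n\}$ $$A^{\wedge k}\,(A^\nabla)^{\wedge k}\ \succeq^\circ\ \mathcal{I},$$ where $\mathcal{I}$ is the $\binom{n}{k}\times\binom{n}{k}$ identity matrix. -/

import Mathlib

/-!
Semirings with a symmetry.

A commutative semiring with a symmetry is given by `[CommSemiring S] [HasDistribNeg S]`: the
symmetry `τ` (written `⊖` in the literature) is the operation `-`, with `τ (τ a) = a` and
`τ (a b) = a τ(b) = τ(a) b`. It is *not* assumed that `a + -a = 0`. The remaining two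
axioms of a symmetry, `τ (a + b) = τ a + τ b` and `τ 0 = 0`, follow and are proved below.
-/

namespace TropCompound

theorem symmetry_add {S : Type*} [CommSemiring S] [HasDistribNeg S] (a b : S) :
    -(a + b) = -a + -b := by
  have h : ∀ x : S, -x = -1 * x := fun x => by rw [neg_mul, one_mul]
  rw [h (a + b), h a, h b, mul_add]

theorem symmetry_zero {S : Type*} [CommSemiring S] [HasDistribNeg S] : -(0 : S) = 0 := by
  have h : -(0 : S) = -1 * 0 := by rw [neg_mul, one_mul]
  rw [h, mul_zero]

/-- The preorder `a ≼ b`, meaning `b = a + c` for some `c`. -/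
def NatLE {S : Type*} [CommSemiring S] (a b : S) : Prop := ∃ c : S, b = a + c

/-- `S` is naturally ordered when the preorder `≼` (always reflexive and transitive)
is an order, i.e. is antisymmetric. -/
def NaturallyOrdered (S : Type*) [CommSemiring S] : Prop :=
  ∀ a b : S, NatLE a b → NatLE b a → a = b

/-- `a° = a ⊖ a`. -/
def circ {S : Type*} [CommSemiring S] [HasDistribNeg S] (a : S) : S := a + -a

/-- `S° = {a° | a ∈ S}`. -/
def circSet (S : Type*) [CommSemiring S] [HasDistribNeg S] : Set S :=
  Set.range (circ : S → S)

/-- `b ≽° a`, meaning `b = a + c` for some `c ∈ S°`. -/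
def CircGE {S : Type*} [CommSemiring S] [HasDistribNeg S] (b a : S) : Prop :=
  ∃ c ∈ circSet S, b = a + c

/-- The relation `≽°` for matrices, entry by entry. -/
def MatrixCircGE {m n S : Type*} [CommSemiring S] [HasDistribNeg S] (B A : Matrix m n S) : Prop :=
  ∀ i j, CircGE (B i j) (A i j)

/-- `S^∨ = S* ∪ {0}`, where `S*` is the set of invertible elements. -/
def veeSet (S : Type*) [CommSemiring S] : Set S := {a | IsUnit a} ∪ {0}

/-- A (commutative) semifield that is idempotent and totally ordered by its natural order. -/
structure IsTotallyOrderedIdempotent (M : Type*) [Semifield M] : Prop where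
  idem : ∀ a : M, a + a = a
  total : ∀ a b : M, NatLE a b ∨ NatLE b a

/-- The standing hypotheses on the semiring with symmetry `S` with modulus `μ : S → M`, written
`S = 𝒯` in the literature: `S` is naturally ordered, `μ` is a surjective morphism onto a totally
ordered idempotent semifield, and the three properties below hold. -/
structure IsTropicalExtension {S M : Type*} [CommSemiring S] [HasDistribNeg S] [Semifield M]
    (μ : S →+* M) : Prop where
  naturallyOrdered : NaturallyOrdered S
  semifield : IsTotallyOrderedIdempotent M
  surjective : Function.Surjective μ
  /-- If `|a| ≺ |b|` then `a + b = b`. -/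
  absorb : ∀ a b : S, NatLE (μ a) (μ b) → μ a ≠ μ b → a + b = b
  /-- If `b ≽ a`, `|a| = |b|` and `b ∈ S^∨`, then `a = b`. -/
  rigid : ∀ a b : S, NatLE a b → μ a = μ b → b ∈ veeSet S → a = b
  /-- `S°` is idempotent. -/
  circ_idem : ∀ a : S, circ a + circ a = circ a

/-- The sign `(⊖1)^{|inv σ|} ∈ S` of a bijection `σ` between finite totally ordered sets, where
`inv σ` is the set of pairs `i < j` with `σ i > σ j`. -/
def bijSign {α β : Type*} [Fintype α] [LinearOrder α] [LinearOrder β] (S : Type*)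
    [CommSemiring S] [HasDistribNeg S] (σ : α ≃ β) : S :=
  (-1) ^ (Finset.univ.filter fun p : α × α => p.1 < p.2 ∧ σ p.2 < σ p.1).card

/-- The determinant `⨁_σ sign(σ) ⨀_i A_{i,σ(i)}` of a matrix with rows and columns indexed by
two finite totally ordered sets, `σ` running over the bijections from the former to the latter. -/
def det {α β S : Type*} [Fintype α] [LinearOrder α] [Fintype β] [LinearOrder β]
    [CommSemiring S] [HasDistribNeg S] (A : Matrix α β S) : S :=
  ∑ σ : α ≃ β, bijSign S σ * ∏ i, A i (σ i)

/-- `A` is nonsingular when its determinant is invertible. -/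
def Nonsingular {n : ℕ} {S : Type*} [CommSemiring S] [HasDistribNeg S]
    (A : Matrix (Fin n) (Fin n) S) : Prop := IsUnit (det A)

/-- The adjoint matrix: its `(i,j)` entry is `(⊖1)^{i+j}` times the determinant of `A` with row `j`
and column `i` deleted. (Counting indices from `0` instead of `1` does not change the sign.) -/
def adj {n : ℕ} {S : Type*} [CommSemiring S] [HasDistribNeg S]
    (A : Matrix (Fin n) (Fin n) S) : Matrix (Fin n) (Fin n) S :=
  Matrix.of fun i j => (-1) ^ ((i : ℕ) + (j : ℕ)) *
    det (Matrix.of fun (r : {r : Fin n // r ≠ j}) (c : {c : Fin n // c ≠ i}) => A r c)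

/-- The quasi-inverse `A^∇ = adj(A) det(A)⁻¹` (meaningful for nonsingular `A`, in which case
`Ring.inverse (det A)` is the inverse of the invertible element `det A`). -/
noncomputable def quasiInverse {n : ℕ} {S : Type*} [CommSemiring S] [HasDistribNeg S]
    (A : Matrix (Fin n) (Fin n) S) : Matrix (Fin n) (Fin n) S :=
  Matrix.of fun i j => adj A i j * Ring.inverse (det A)

/-- The `k`-element subsets of the index set. -/
abbrev KSubset (n k : ℕ) : Type := {I : Finset (Fin n) // I.card = k}

/-- The `k`-th compound matrix `A^{∧k}`, indexed by the `k`-element subsets: its `(I,J)` entry is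
`⨁_σ sign(σ) ⨀_{i ∈ I} A_{i,σ(i)}`, `σ` running over the bijections from `I` to `J`. -/
def compound {n : ℕ} {S : Type*} [CommSemiring S] [HasDistribNeg S] (k : ℕ)
    (A : Matrix (Fin n) (Fin n) S) : Matrix (KSubset n k) (KSubset n k) S :=
  Matrix.of fun I J => det (Matrix.of fun (i : {i // i ∈ I.1}) (j : {j // j ∈ J.1}) => A i j)

end TropCompound

/-!
Over a commutative ring, the Cauchy–Binet formula and `A * adj A = det A • 1` give
`compound k A * compound k (adj A) = det A ^ k • 1` (`compound_mul_compound_adj`). The proof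
transfers this identity to a semiring with symmetry `S`.

The transfer compares an expression in `S` with the polynomial in `ℤ[x]` obtained by computing the
same expression on the generic matrix. A polynomial `d` over `ℤ`, written in reduced form, has a
value `signedEval a d` in `S`, where an integer coefficient is read as a multiple of `1` or of
`⊖1`. Two monomials that cancel over `ℤ` contribute an element `c ⊖ c` of `S°` in `S`, so the value
of the expression in `S` is `signedEval a d` plus an element of `S°`. This is the relation
`IsLift a d s`, which is preserved by sums, products and the symmetry, hence by determinants,
adjoints and compounds.

Off the diagonal, the entries of `compound k A * compound k (adj A)` lift to the zero polynomial, so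
they lie in `S°`. On the diagonal they lift to `det ^ k`, and the point is that
`signedEval a (det ^ k)` is equal to `det A ^ k`
(`IsTropicalExtension.signedEval_det_pow`). Since `det A ^ k` itself lifts to `det ^ k`, it is
`≽` that value. Conversely, as the moduli are totally ordered and addition of moduli is idempotent,
some permutation has a monomial of the same modulus as `det A`; as `det A` is invertible, this
monomial equals `det A`. Its `k`-th power arises only once in the expansion of `det ^ k`, so it
survives in the reduced form, whose value is therefore `≽ det A ^ k`. Antisymmetry of `≼` gives
equality. Multiplying by the `k`-th power of the inverse of `det A` turns `adj A` into the
quasi-inverse.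
-/

namespace TropCompound


/-! ### Determinants over a commutative ring -/

section Ring

variable {R : Type*} [CommRing R]

/-- Counting inversions gives the usual sign of a permutation. -/
theorem bijSign_eq_sign {k : ℕ} {α β : Type*} [Fintype α] [LinearOrder α] [LinearOrder β]
    (e : Fin k ≃o α) (f : Fin k ≃o β) (σ : Equiv.Perm (Fin k)) :
    bijSign R ((e.symm.toEquiv.trans σ).trans f.toEquiv) = ((Equiv.Perm.sign σ : ℤ) : R) := by
  have h : (Finset.univ.filter fun p : α × α => p.1 < p.2 ∧
      ((e.symm.toEquiv.trans σ).trans f.toEquiv) p.2 <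
        ((e.symm.toEquiv.trans σ).trans f.toEquiv) p.1).card =
      (Finset.univ.filter fun p : Fin k × Fin k => p.1 < p.2 ∧ σ p.2 < σ p.1).card := by
    refine (Finset.card_equiv (e.toEquiv.prodCongr e.toEquiv) fun p => ?_).symm
    simp
  rw [bijSign, h, Equiv.Perm.sign_eq_prod_prod_Ioi, Finset.prod_sigma']
  have h2 : ∀ x : (_ : Fin k) × Fin k, (if σ x.1 < σ x.2 then (1 : ℤˣ) else -1) =
      if σ x.2 ≤ σ x.1 then -1 else 1 := fun x => by
    by_cases hx : σ x.1 < σ x.2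
    · rw [if_pos hx, if_neg (not_le.2 hx)]
    · rw [if_neg hx, if_pos (not_lt.1 hx)]
  simp_rw [h2]
  rw [← Finset.prod_filter, Finset.prod_const]
  push_cast
  congr 1
  refine Finset.card_bij' (fun p _ => ⟨p.1, p.2⟩) (fun p _ => (p.1, p.2)) ?_ ?_ ?_ ?_
  · intro p hp
    simp only [Finset.mem_filter, Finset.mem_univ, true_and, Finset.mem_sigma,
      Finset.mem_Ioi] at hp ⊢
    exact ⟨hp.1, hp.2.le⟩
  · rintro ⟨i, j⟩ hp
    simp only [Finset.mem_filter, Finset.mem_univ, true_and, Finset.mem_sigma,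
      Finset.mem_Ioi] at hp ⊢
    exact ⟨hp.1, lt_of_le_of_ne hp.2 fun h => hp.1.ne' (σ.injective h)⟩
  · intro p _; rfl
  · intro p _; rfl

/-- Over a ring, `det` is the usual determinant once rows and columns are numbered increasingly. -/
theorem det_eq_matrix_det {k : ℕ} {α β : Type*} [Fintype α] [LinearOrder α] [Fintype β]
    [LinearOrder β] (e : Fin k ≃o α) (f : Fin k ≃o β) (A : Matrix α β R) :
    det A = (A.submatrix e f).det := by
  rw [det, ← Matrix.det_transpose, Matrix.det_apply']
  symm
  refine Fintype.sum_equiv (e.toEquiv.equivCongr f.toEquiv) _ _ fun σ => ?_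
  have h := bijSign_eq_sign (R := R) e f σ
  have h' : e.toEquiv.equivCongr f.toEquiv σ = (e.symm.toEquiv.trans σ).trans f.toEquiv := rfl
  rw [h', h]
  congr 1
  refine Fintype.prod_equiv e.toEquiv _ _ fun i => ?_
  simp

theorem compound_apply_eq_matrix_det {n k : ℕ} (A : Matrix (Fin n) (Fin n) R)
    (I J : KSubset n k) :
    compound k A I J =
      (A.submatrix (I.1.orderEmbOfFin I.2) (J.1.orderEmbOfFin J.2)).det := by
  rw [compound, Matrix.of_apply, det_eq_matrix_det (I.1.orderIsoOfFin I.2) (J.1.orderIsoOfFin J.2)]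
  rfl

theorem adj_eq_adjugate {n : ℕ} (A : Matrix (Fin n) (Fin n) R) : adj A = A.adjugate := by
  cases n with
  | zero => ext i; exact i.elim0
  | succ n =>
    ext i j
    rw [Matrix.adjugate_fin_succ_eq_det_submatrix, adj, Matrix.of_apply,
      det_eq_matrix_det (finSuccAboveOrderIso j) (finSuccAboveOrderIso i), add_comm]
    rfl

/-- The Cauchy–Binet formula. Expanding the rows of `M * N` gives a sum over all maps
`p : Fin k → Fin n`; those that are not injective contribute nothing, and the injective ones
factor uniquely as a permutation followed by an increasing enumeration of their range. -/
theorem cauchyBinet {n k : ℕ} (M : Matrix (Fin k) (Fin n) R) (N : Matrix (Fin n) (Fin k) R) :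
    (M * N).det = ∑ K : KSubset n k,
      (M.submatrix id (K.1.orderEmbOfFin K.2)).det *
        (N.submatrix (K.1.orderEmbOfFin K.2) id).det := by
  have hexp : (M * N).det =
      ∑ p : Fin k → Fin n, (∏ i, M i (p i)) * (N.submatrix p id).det := by
    have h : (M * N) = fun i => ∑ j, M i j • N j := by
      ext i l; simp [Matrix.mul_apply]
    rw [h]
    have := (Matrix.detRowAlternating : (Fin k → R) [⋀^Fin k]→ₗ[R] R).toMultilinearMap.map_sum
      (fun i j => M i j • N j)
    refine this.trans (Finset.sum_congr rfl fun p _ => ?_)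
    rw [MultilinearMap.map_smul_univ, smul_eq_mul]
    rfl
  have hM : ∀ K : KSubset n k, (M.submatrix id (K.1.orderEmbOfFin K.2)).det =
      ∑ τ : Equiv.Perm (Fin k),
        ((Equiv.Perm.sign τ : ℤ) : R) * ∏ i, M i (K.1.orderEmbOfFin K.2 (τ i)) := fun K => by
    rw [← Matrix.det_transpose, Matrix.det_apply']
    rfl
  simp_rw [hM, Finset.sum_mul]
  rw [hexp, ← Fintype.sum_prod_type' (f := fun (K : KSubset n k) (τ : Equiv.Perm (Fin k)) =>
    ((Equiv.Perm.sign τ : ℤ) : R) * (∏ i, M i (K.1.orderEmbOfFin K.2 (τ i))) *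
      (N.submatrix (K.1.orderEmbOfFin K.2) id).det)]
  symm
  have hrange : ∀ (K : KSubset n k) (τ : Equiv.Perm (Fin k)),
      Finset.univ.image (fun i => K.1.orderEmbOfFin K.2 (τ i)) = K.1 := fun K τ => by
    apply Finset.coe_injective
    rw [Finset.coe_image, Finset.coe_univ, Set.image_univ]
    have : Set.range (fun i => K.1.orderEmbOfFin K.2 (τ i)) =
      Set.range (K.1.orderEmbOfFin K.2) := τ.surjective.range_comp (K.1.orderEmbOfFin K.2)
    rw [this, Finset.range_orderEmbOfFin]
  refine Finset.sum_of_injOn (fun x i => x.1.1.orderEmbOfFin x.1.2 (x.2 i)) ?_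
    (fun _ _ => Finset.mem_coe.2 (Finset.mem_univ _)) ?_ ?_
  · rintro ⟨K, τ⟩ _ ⟨K', τ'⟩ _ h
    have hK : K = K' := by
      apply Subtype.ext
      rw [← hrange K τ, ← hrange K' τ']
      exact congrArg (fun p => Finset.univ.image p) h
    subst hK
    congr 1
    ext1 i
    exact (K.1.orderEmbOfFin K.2).injective (congrFun h i)
  · intro p _ hp
    by_cases hinj : Function.Injective p
    · refine absurd ?_ hp
      let K : KSubset n k := ⟨Finset.univ.image p, by
        rw [Finset.card_image_of_injective _ hinj, Finset.card_univ, Fintype.card_fin]⟩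
      have hmem : ∀ i, p i ∈ K.1 := fun i => Finset.mem_image_of_mem p (Finset.mem_univ i)
      let q : Fin k → Fin k := fun i => (K.1.orderIsoOfFin K.2).symm ⟨p i, hmem i⟩
      have hq : Function.Injective q := fun i j h => by
        have := (K.1.orderIsoOfFin K.2).symm.injective h
        exact hinj (congrArg Subtype.val this)
      refine ⟨(K, Equiv.ofBijective q (Finite.injective_iff_bijective.1 hq)),
        Finset.mem_coe.2 (Finset.mem_univ _), ?_⟩
      funext i
      change ((K.1.orderIsoOfFin K.2) ((K.1.orderIsoOfFin K.2).symm ⟨p i, hmem i⟩) : Fin n) = p i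
      rw [OrderIso.apply_symm_apply]
    · simp only [Function.Injective, not_forall] at hinj
      obtain ⟨i, j, hij, hne⟩ := hinj
      rw [Matrix.det_zero_of_row_eq hne, mul_zero]
      funext l
      simp [hij]
  · rintro ⟨K, τ⟩ _
    have := Matrix.det_permute τ (N.submatrix (K.1.orderEmbOfFin K.2) id)
    rw [Matrix.submatrix_submatrix] at this
    change _ = (∏ i, M i (K.1.orderEmbOfFin K.2 (τ i))) *
      (N.submatrix (K.1.orderEmbOfFin K.2 ∘ τ) (id ∘ id)).det
    rw [this]
    ring

theorem compound_mul {n k : ℕ} (A B : Matrix (Fin n) (Fin n) R) :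
    compound k (A * B) = compound k A * compound k B := by
  ext I J
  rw [compound_apply_eq_matrix_det, Matrix.mul_apply,
    Matrix.submatrix_mul A B _ id _ Function.bijective_id, cauchyBinet]
  refine Finset.sum_congr rfl fun K _ => ?_
  rw [compound_apply_eq_matrix_det, compound_apply_eq_matrix_det]
  rfl

theorem compound_smul_one {n k : ℕ} (c : R) :
    compound k (c • (1 : Matrix (Fin n) (Fin n) R)) = c ^ k • 1 := by
  ext I J
  rw [compound_apply_eq_matrix_det, Matrix.smul_apply, smul_eq_mul]
  by_cases h : I = J
  · subst h
    rw [Matrix.one_apply_eq, Matrix.submatrix_smul, Pi.smul_apply, Pi.smul_apply,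
      Matrix.submatrix_one _ (I.1.orderEmbOfFin I.2).injective, Matrix.det_smul, Matrix.det_one,
      Fintype.card_fin]
  · rw [Matrix.one_apply_ne h, mul_zero]
    obtain ⟨i, hi, hiJ⟩ : ∃ i ∈ I.1, i ∉ J.1 := by
      by_contra! hsub
      exact h (Subtype.ext (Finset.eq_of_subset_of_card_le hsub (by rw [I.2, J.2])))
    obtain ⟨r, rfl⟩ : i ∈ Set.range (I.1.orderEmbOfFin I.2) := by
      rwa [Finset.range_orderEmbOfFin]
    refine Matrix.det_eq_zero_of_row_eq_zero r fun l => ?_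
    rw [Matrix.submatrix_apply, Matrix.smul_apply, Matrix.one_apply_ne, smul_zero]
    rintro heq
    exact hiJ (heq ▸ Finset.orderEmbOfFin_mem _ _ _)

theorem compound_mul_compound_adj {n k : ℕ} (A : Matrix (Fin n) (Fin n) R) :
    compound k A * compound k (adj A) = det A ^ k • 1 := by
  rw [← compound_mul, adj_eq_adjugate, Matrix.mul_adjugate, compound_smul_one,
    det_eq_matrix_det (OrderIso.refl (Fin n)) (OrderIso.refl (Fin n))]
  rfl

end Ring


/-! ### Lifting a value to a polynomial with integer coefficients -/

section Lift

open MvPolynomial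

variable {S : Type*} [CommSemiring S] [HasDistribNeg S]

theorem circ_add (a b : S) : circ a + circ b = circ (a + b) := by
  rw [circ, circ, circ, symmetry_add, add_add_add_comm]

theorem mul_circ (a b : S) : a * circ b = circ (a * b) := by
  rw [circ, circ, mul_add, mul_neg]

theorem circ_mul (a b : S) : circ a * b = circ (a * b) := by
  rw [circ, circ, add_mul, neg_mul]

theorem circ_zero : circ (0 : S) = 0 := by
  rw [circ, symmetry_zero, add_zero]

theorem sum_circ {ι : Type*} (s : Finset ι) (f : ι → S) :
    ∑ i ∈ s, circ (f i) = circ (∑ i ∈ s, f i) := by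
  classical
  induction s using Finset.induction_on with
  | empty => simp [circ_zero]
  | insert i s hi ih => rw [Finset.sum_insert hi, Finset.sum_insert hi, ih, circ_add]

/-- The integer `z` read in a semiring with symmetry: `|z|` copies of `1` or of `⊖1`. This is
multiplicative, but additive only up to an element of `S°`. -/
def signedCast (S : Type*) [CommSemiring S] [HasDistribNeg S] (z : ℤ) : S :=
  (z.toNat : S) + -((-z).toNat : S)

theorem signedCast_zero : signedCast S 0 = 0 := by
  simp [signedCast]

theorem signedCast_natCast (m : ℕ) : signedCast S m = m := by
  simp [signedCast]

theorem signedCast_neg_natCast (m : ℕ) : signedCast S (-m) = -(m : S) := by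
  simp [signedCast]

theorem signedCast_one : signedCast S 1 = 1 := by
  simpa using signedCast_natCast (S := S) 1

theorem signedCast_neg_one : signedCast S (-1) = -1 := by
  simpa using signedCast_neg_natCast (S := S) 1

theorem signedCast_mul (z w : ℤ) : signedCast S (z * w) = signedCast S z * signedCast S w := by
  obtain ⟨m, rfl | rfl⟩ := z.eq_nat_or_neg <;> obtain ⟨l, rfl | rfl⟩ := w.eq_nat_or_neg <;>
    simp only [neg_mul, mul_neg, neg_neg, ← Nat.cast_mul, signedCast_natCast,
      signedCast_neg_natCast]

theorem signedCast_pow (z : ℤ) (m : ℕ) : signedCast S (z ^ m) = signedCast S z ^ m := by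
  induction m with
  | zero => simp [signedCast_one]
  | succ m ih => rw [pow_succ, pow_succ, signedCast_mul, ih]

theorem signedCast_add (z w : ℤ) :
    ∃ c : S, signedCast S z + signedCast S w = signedCast S (z + w) + circ c := by
  obtain ⟨e, h1, h2⟩ : ∃ e : ℕ, z.toNat + w.toNat = (z + w).toNat + e ∧
      (-z).toNat + (-w).toNat = (-(z + w)).toNat + e :=
    ⟨z.toNat + w.toNat - (z + w).toNat, by omega, by omega⟩
  refine ⟨e, ?_⟩
  rw [signedCast, signedCast, signedCast, circ, add_add_add_comm (z.toNat : S),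
    add_add_add_comm ((z + w).toNat : S),
    ← symmetry_add, ← symmetry_add, ← Nat.cast_add, ← Nat.cast_add, ← Nat.cast_add,
    ← Nat.cast_add, h1, h2]

variable {ι : Type*}

/-- The value at `a : ι → S` of a polynomial with integer coefficients, each coefficient being
read in `S` through `signedCast`. It is computed from the reduced form, after cancellation
of monomials, so it is additive only up to elements of `S°`. -/
noncomputable def signedEval (a : ι → S) (d : MvPolynomial ι ℤ) : S :=
  ∑ m ∈ d.support, signedCast S (coeff m d) * eval a (monomial m 1)

theorem signedEval_eq_sum {a : ι → S} {d : MvPolynomial ι ℤ} {T : Finset (ι →₀ ℕ)}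
    (hT : d.support ⊆ T) :
    signedEval a d = ∑ m ∈ T, signedCast S (coeff m d) * eval a (monomial m 1) := by
  refine Finset.sum_subset hT fun m _ hm => ?_
  rw [notMem_support_iff.1 hm, signedCast_zero, zero_mul]

theorem signedEval_zero (a : ι → S) : signedEval a 0 = 0 := by
  simp [signedEval]

theorem signedEval_monomial (a : ι → S) (m : ι →₀ ℕ) (z : ℤ) :
    signedEval a (monomial m z) = signedCast S z * eval a (monomial m 1) := by
  classical
  rw [signedEval_eq_sum (T := {m}) support_monomial_subset, Finset.sum_singleton, coeff_monomial,
    if_pos rfl]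

theorem natLE_signedEval (a : ι → S) (d : MvPolynomial ι ℤ) (m : ι →₀ ℕ) :
    NatLE (signedCast S (coeff m d) * eval a (monomial m 1)) (signedEval a d) := by
  classical
  rw [signedEval_eq_sum (Finset.subset_insert m d.support)]
  exact ⟨_, (Finset.add_sum_erase _ _ (Finset.mem_insert_self m _)).symm⟩

/-- `IsLift a d s` says that `s` is the signed value at `a` of the reduced polynomial `d`, plus an
element of `S°`. Any polynomial expression in the `a i` with formal signs satisfies this with
`d` the same expression computed over `ℤ`: monomials cancelling over `ℤ` pair up to elements
of `S°`. -/
def IsLift (a : ι → S) (d : MvPolynomial ι ℤ) (s : S) : Prop :=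
  ∃ c : S, s = signedEval a d + circ c

variable {a : ι → S} {d e : MvPolynomial ι ℤ} {s t : S}

theorem isLift_zero : IsLift a 0 0 := ⟨0, by rw [signedEval_zero, circ_zero, add_zero]⟩

theorem isLift_monomial (m : ι →₀ ℕ) (z : ℤ) :
    IsLift a (monomial m z) (signedCast S z * eval a (monomial m 1)) :=
  ⟨0, by rw [signedEval_monomial, circ_zero, add_zero]⟩

theorem IsLift.add_circ (h : IsLift a d s) (c : S) : IsLift a d (s + circ c) := by
  obtain ⟨c', rfl⟩ := h
  exact ⟨c' + c, by rw [add_assoc, circ_add]⟩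

theorem IsLift.add (hs : IsLift a d s) (ht : IsLift a e t) : IsLift a (d + e) (s + t) := by
  classical
  obtain ⟨c, rfl⟩ := hs
  obtain ⟨c', rfl⟩ := ht
  choose f hf using signedCast_add (S := S)
  have h : signedEval a d + signedEval a e = signedEval a (d + e) +
      circ (∑ m ∈ d.support ∪ e.support,
        f (coeff m d) (coeff m e) * eval a (monomial m 1)) := by
    rw [signedEval_eq_sum (T := d.support ∪ e.support) Finset.subset_union_left,
      signedEval_eq_sum (T := d.support ∪ e.support) Finset.subset_union_right,
      signedEval_eq_sum (T := d.support ∪ e.support) support_add, ← sum_circ,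
      ← Finset.sum_add_distrib, ← Finset.sum_add_distrib]
    refine Finset.sum_congr rfl fun m _ => ?_
    rw [← add_mul, hf, coeff_add, add_mul, circ_mul]
  rw [add_add_add_comm, h, circ_add]
  exact IsLift.add_circ ⟨_, rfl⟩ _

theorem IsLift.sum {κ : Type*} {T : Finset κ} {f : κ → MvPolynomial ι ℤ} {g : κ → S}
    (h : ∀ i ∈ T, IsLift a (f i) (g i)) : IsLift a (∑ i ∈ T, f i) (∑ i ∈ T, g i) := by
  classical
  induction T using Finset.induction_on with
  | empty => simpa using isLift_zero
  | insert i T hi ih =>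
    rw [Finset.sum_insert hi, Finset.sum_insert hi]
    exact (h i (Finset.mem_insert_self i T)).add
      (ih fun j hj => h j (Finset.mem_insert_of_mem hj))

theorem IsLift.mul (hs : IsLift a d s) (ht : IsLift a e t) : IsLift a (d * e) (s * t) := by
  obtain ⟨c, rfl⟩ := hs
  obtain ⟨c', rfl⟩ := ht
  have h : IsLift a (d * e) (signedEval a d * signedEval a e) := by
    conv => enter [2]; rw [d.as_sum, e.as_sum]
    rw [signedEval, signedEval, Finset.sum_mul_sum, Finset.sum_mul_sum]
    refine IsLift.sum fun m _ => IsLift.sum fun m' _ => ?_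
    have := isLift_monomial (a := a) (m + m') (coeff m d * coeff m' e)
    have h1 : (monomial (m + m') (1 : S)) = monomial m 1 * monomial m' 1 := by
      rw [monomial_mul, one_mul]
    rw [monomial_mul]
    rwa [signedCast_mul, h1, map_mul (eval a), mul_mul_mul_comm] at this
  rw [mul_add, add_mul, circ_mul, mul_circ]
  exact (h.add_circ _).add_circ _

theorem isLift_one : IsLift a 1 1 := by
  simpa [signedCast_one] using isLift_monomial (a := a) 0 1

theorem isLift_neg_one : IsLift a (-1) (-1) := by
  have := isLift_monomial (a := a) 0 (-1)
  rw [signedCast_neg_one] at this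
  simpa using this

theorem isLift_X (i : ι) : IsLift a (X i) (a i) := by
  have := isLift_monomial (a := a) (Finsupp.single i 1) 1
  rwa [signedCast_one, one_mul, ← X, ← X, eval_X] at this

theorem IsLift.prod {κ : Type*} {T : Finset κ} {f : κ → MvPolynomial ι ℤ} {g : κ → S}
    (h : ∀ i ∈ T, IsLift a (f i) (g i)) : IsLift a (∏ i ∈ T, f i) (∏ i ∈ T, g i) := by
  classical
  induction T using Finset.induction_on with
  | empty => simpa using isLift_one
  | insert i T hi ih =>
    rw [Finset.prod_insert hi, Finset.prod_insert hi]
    exact (h i (Finset.mem_insert_self i T)).mul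
      (ih fun j hj => h j (Finset.mem_insert_of_mem hj))

theorem IsLift.pow (h : IsLift a d s) (k : ℕ) : IsLift a (d ^ k) (s ^ k) := by
  simpa using IsLift.prod (T := Finset.range k) fun _ _ => h

theorem isLift_det {α β : Type*} [Fintype α] [LinearOrder α] [Fintype β] [LinearOrder β]
    {D : Matrix α β (MvPolynomial ι ℤ)} {A : Matrix α β S}
    (h : ∀ i j, IsLift a (D i j) (A i j)) : IsLift a (det D) (det A) :=
  IsLift.sum fun σ _ => (isLift_neg_one.pow _).mul (IsLift.prod fun i _ => h i (σ i))

theorem isLift_adj {n : ℕ} {D : Matrix (Fin n) (Fin n) (MvPolynomial ι ℤ)}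
    {A : Matrix (Fin n) (Fin n) S} (h : ∀ i j, IsLift a (D i j) (A i j)) (i j : Fin n) :
    IsLift a (adj D i j) (adj A i j) :=
  (isLift_neg_one.pow _).mul (isLift_det fun _ _ => h _ _)

theorem isLift_compound {n k : ℕ} {D : Matrix (Fin n) (Fin n) (MvPolynomial ι ℤ)}
    {A : Matrix (Fin n) (Fin n) S} (h : ∀ i j, IsLift a (D i j) (A i j)) (I J : KSubset n k) :
    IsLift a (compound k D I J) (compound k A I J) :=
  isLift_det fun _ _ => h _ _

/-- The generic `n × n` matrix. -/
noncomputable def genericMatrix (n : ℕ) :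
    Matrix (Fin n) (Fin n) (MvPolynomial (Fin n × Fin n) ℤ) :=
  Matrix.of fun i j => X (i, j)

theorem isLift_compound_mul_compound_adj {n : ℕ} (A : Matrix (Fin n) (Fin n) S) (k : ℕ)
    (I J : KSubset n k) :
    IsLift (fun p : Fin n × Fin n => A p.1 p.2)
      (det (genericMatrix n) ^ k * (1 : Matrix _ _ (MvPolynomial (Fin n × Fin n) ℤ)) I J)
      ((compound k A * compound k (adj A)) I J) := by
  have hX : ∀ i j, IsLift (fun p : Fin n × Fin n => A p.1 p.2) (genericMatrix n i j) (A i j) :=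
    fun i j => isLift_X (a := fun p : Fin n × Fin n => A p.1 p.2) (i, j)
  rw [← smul_eq_mul, ← Matrix.smul_apply, ← compound_mul_compound_adj, Matrix.mul_apply,
    Matrix.mul_apply]
  exact IsLift.sum fun K _ => (isLift_compound hX I K).mul (isLift_compound (isLift_adj hX) K J)

theorem isLift_det_pow {n : ℕ} (A : Matrix (Fin n) (Fin n) S) (k : ℕ) :
    IsLift (fun p : Fin n × Fin n => A p.1 p.2) (det (genericMatrix n) ^ k) (det A ^ k) :=
  (isLift_det fun i j => isLift_X (a := fun p : Fin n × Fin n => A p.1 p.2) (i, j)).pow k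

end Lift


/-! ### Dominant monomials -/

section Coefficient

open MvPolynomial

/-- Setting to zero the variables outside the range of `f` does not change the coefficients of the
monomials in the remaining variables. -/
theorem coeff_killCompl {σ τ R : Type*} [CommSemiring R] {f : σ → τ}
    (hf : Function.Injective f) (s : σ →₀ ℕ) (p : MvPolynomial τ R) :
    coeff s (killCompl hf p) = coeff (s.mapDomain f) p := by
  classical
  induction p using MvPolynomial.induction_on' with
  | add p q hp hq => rw [map_add, coeff_add, coeff_add, hp, hq]
  | monomial u c =>
    by_cases hu : (u.support : Set τ) ⊆ Set.range f
    · obtain ⟨v, rfl⟩ : ∃ v : σ →₀ ℕ, v.mapDomain f = u :=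
        ⟨u.comapDomain f hf.injOn, Finsupp.mapDomain_comapDomain f hf u hu⟩
      rw [killCompl_monomial_mapDomain, coeff_monomial, coeff_monomial]
      simp only [(Finsupp.mapDomain_injective hf).eq_iff]
    · rw [killCompl_monomial_eq_zero_of_not_subset hf c hu, coeff_zero, coeff_monomial, if_neg]
      rintro rfl
      refine hu fun x hx => ?_
      obtain ⟨y, -, rfl⟩ := Finset.mem_image.1 (Finsupp.mapDomain_support hx)
      exact ⟨y, rfl⟩

theorem monomial_sum_single {σ R : Type*} [Fintype σ] [CommSemiring R] (k : ℕ) :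
    monomial (∑ i : σ, Finsupp.single i k) (1 : R) = (∏ i, X i) ^ k := by
  rw [monomial_sum_one, ← Finset.prod_pow]
  simp_rw [X_pow_eq_monomial]

/-- The parametrization of the graph of a permutation, that is, of the positions of the matrix
entries (or generic variables) that enter its monomial in the determinant. -/
def graph {n : ℕ} (σ : Equiv.Perm (Fin n)) (i : Fin n) : Fin n × Fin n := (i, σ i)

theorem graph_injective {n : ℕ} (σ : Equiv.Perm (Fin n)) : Function.Injective (graph σ) :=
  fun _ _ h => congrArg Prod.fst h

theorem killCompl_det_genericMatrix {n : ℕ} (σ : Equiv.Perm (Fin n)) :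
    killCompl (graph_injective σ) (det (genericMatrix n)) =
      C (bijSign ℤ σ) * ∏ i, X i := by
  have hX : ∀ i, killCompl (R := ℤ) (graph_injective σ) (X (i, σ i)) = X i := fun i => by
    have := killCompl_rename_app (R := ℤ) (graph_injective σ) (X i)
    rwa [rename_X] at this
  have h0 : ∀ i j, j ≠ σ i → killCompl (R := ℤ) (graph_injective σ) (X (i, j)) = 0 := by
    intro i j hj
    rw [killCompl, aeval_X, dif_neg]
    rintro ⟨l, hl⟩
    obtain ⟨rfl, rfl⟩ := Prod.ext_iff.1 hl
    exact hj rfl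
  rw [det, map_sum, Finset.sum_eq_single_of_mem σ (Finset.mem_univ σ)]
  · rw [map_mul, map_prod, bijSign, bijSign, map_pow, map_neg, map_one, map_pow, map_neg, map_one]
    simp [genericMatrix, hX]
  · intro τ _ hτ
    obtain ⟨i, hi⟩ : ∃ i, τ i ≠ σ i := by
      by_contra! h
      exact hτ (Equiv.ext h)
    rw [map_mul, map_prod, Finset.prod_eq_zero (Finset.mem_univ i) (h0 i (τ i) hi), mul_zero]

/-- The monomial attached to a permutation occurs, raised to the power `k`, in the reduced form
of `det ^ k` with the expected sign: setting to zero the variables off the graph of `σ` leaves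
only this monomial. -/
theorem natLE_signedEval_det_pow {S : Type*} [CommSemiring S] [HasDistribNeg S] {n : ℕ}
    (A : Matrix (Fin n) (Fin n) S) (σ : Equiv.Perm (Fin n)) (k : ℕ) :
    NatLE ((bijSign S σ * ∏ i, A i (σ i)) ^ k)
      (signedEval (fun p : Fin n × Fin n => A p.1 p.2) (det (genericMatrix n) ^ k)) := by
  let s : Fin n →₀ ℕ := ∑ i, Finsupp.single i k
  have hcoeff : coeff (s.mapDomain (graph σ)) (det (genericMatrix n) ^ k) = bijSign ℤ σ ^ k := by
    rw [← coeff_killCompl (graph_injective σ), map_pow, killCompl_det_genericMatrix, mul_pow,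
      ← monomial_sum_single, ← C_pow, coeff_C_mul, coeff_monomial, if_pos rfl, mul_one]
  have heval : eval (fun p : Fin n × Fin n => A p.1 p.2) (monomial (s.mapDomain (graph σ)) 1) =
      (∏ i, A i (σ i)) ^ k := by
    rw [← rename_monomial, monomial_sum_single, eval_rename, map_pow, map_prod]
    simp [graph]
  have hsign : signedCast S (bijSign ℤ σ) = bijSign S σ := by
    rw [bijSign, bijSign, signedCast_pow, signedCast_neg_one]
  have := natLE_signedEval (fun p : Fin n × Fin n => A p.1 p.2) (det (genericMatrix n) ^ k)
    (s.mapDomain (graph σ))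
  rwa [hcoeff, heval, signedCast_pow, hsign, ← mul_pow] at this

end Coefficient

section Dominant

theorem IsTotallyOrderedIdempotent.exists_sum_eq {M : Type*} [Semifield M]
    (hM : IsTotallyOrderedIdempotent M) {κ : Type*} {T : Finset κ} (hT : T.Nonempty)
    (f : κ → M) : ∃ i ∈ T, ∑ j ∈ T, f j = f i := by
  have habs : ∀ a b : M, NatLE a b → a + b = b := by
    rintro a _ ⟨c, rfl⟩
    rw [← add_assoc, hM.idem]
  induction hT using Finset.Nonempty.cons_induction with
  | singleton i => exact ⟨i, Finset.mem_singleton_self i, Finset.sum_singleton f i⟩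
  | cons i T hi _ ih =>
    obtain ⟨j, hj, h⟩ := ih
    rw [Finset.sum_cons, h]
    rcases hM.total (f i) (f j) with hij | hij
    · exact ⟨j, Finset.mem_cons_of_mem hj, habs _ _ hij⟩
    · exact ⟨i, Finset.mem_cons_self i T, by rw [add_comm, habs _ _ hij]⟩

variable {S M : Type*} [CommSemiring S] [HasDistribNeg S] [Semifield M] {μ : S →+* M}

/-- A term of maximal modulus in an invertible determinant is equal to the determinant. -/
theorem IsTropicalExtension.exists_det_eq (hS : IsTropicalExtension μ) {n : ℕ}
    {A : Matrix (Fin n) (Fin n) S} (hA : Nonsingular A) :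
    ∃ σ : Equiv.Perm (Fin n), bijSign S σ * ∏ i, A i (σ i) = det A := by
  obtain ⟨σ, hσ, h⟩ := hS.semifield.exists_sum_eq (Finset.univ_nonempty)
    fun σ : Equiv.Perm (Fin n) => μ (bijSign S σ * ∏ i, A i (σ i))
  refine ⟨σ, hS.rigid _ _ ?_ ?_ (Or.inl hA)⟩
  · exact ⟨_, (Finset.add_sum_erase _ (fun σ : Equiv.Perm (Fin n) =>
      bijSign S σ * ∏ i, A i (σ i)) hσ).symm⟩
  · rw [← h, det, map_sum]

/-- The reduced form of `det ^ k` has the same value as `det A ^ k`: it is below it because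
cancelled monomials only add elements of `S°`, and above it because the `k`-th power of a dominant
monomial does not cancel. -/
theorem IsTropicalExtension.signedEval_det_pow (hS : IsTropicalExtension μ) {n : ℕ}
    {A : Matrix (Fin n) (Fin n) S} (hA : Nonsingular A) (k : ℕ) :
    signedEval (fun p : Fin n × Fin n => A p.1 p.2) (det (genericMatrix n) ^ k) = det A ^ k := by
  refine hS.naturallyOrdered _ _ ?_ ?_
  · obtain ⟨c, hc⟩ := isLift_det_pow A k
    exact ⟨_, hc⟩
  · -- The monomial of `σ` is the whole determinant, so its `k`-th power is `det A ^ k`.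
    obtain ⟨σ, hσ⟩ := hS.exists_det_eq hA
    rw [← hσ]
    exact natLE_signedEval_det_pow A σ k

/-- The ring identity `compound k A * compound k (adj A) = det A ^ k • 1` survives in `S` up to
elements of `S°`. -/
theorem exists_compound_mul_compound_adj_eq (hS : IsTropicalExtension μ) {n : ℕ}
    {A : Matrix (Fin n) (Fin n) S} (hA : Nonsingular A) (k : ℕ) (I J : KSubset n k) :
    ∃ c : S, (compound k A * compound k (adj A)) I J =
      det A ^ k * (1 : Matrix _ _ S) I J + circ c := by
  obtain ⟨c, hc⟩ := isLift_compound_mul_compound_adj A k I J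
  refine ⟨c, hc.trans ?_⟩
  by_cases h : I = J
  · subst h
    rw [Matrix.one_apply_eq, Matrix.one_apply_eq, mul_one, mul_one, hS.signedEval_det_pow hA]
  · rw [Matrix.one_apply_ne h, Matrix.one_apply_ne h, mul_zero, mul_zero, signedEval_zero]

end Dominant

/-! ### Compounds of the quasi-inverse -/

theorem det_mul_const {α β S : Type*} [Fintype α] [LinearOrder α] [Fintype β] [LinearOrder β]
    [CommSemiring S] [HasDistribNeg S] (A : Matrix α β S) (u : S) :
    det (Matrix.of fun i j => A i j * u) = det A * u ^ Fintype.card α := by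
  rw [det, det, Finset.sum_mul]
  refine Finset.sum_congr rfl fun σ _ => ?_
  simp only [Matrix.of_apply]
  rw [Finset.prod_mul_distrib, Finset.prod_const, Finset.card_univ, mul_assoc]

theorem compound_quasiInverse {n : ℕ} {S : Type*} [CommSemiring S] [HasDistribNeg S]
    (A : Matrix (Fin n) (Fin n) S) (k : ℕ) (I J : KSubset n k) :
    compound k (quasiInverse A) I J = compound k (adj A) I J * Ring.inverse (det A) ^ k := by
  have := det_mul_const
    (Matrix.of fun (i : {i // i ∈ I.1}) (j : {j // j ∈ J.1}) => adj A i j) (Ring.inverse (det A))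
  rw [Fintype.card_coe, I.2] at this
  exact this

end TropCompound

theorem proposition4p2 {S M : Type*} [CommSemiring S] [HasDistribNeg S] [Semifield M]
    (μ : S →+* M) (hS : TropCompound.IsTropicalExtension μ)
    (n : ℕ) (A : Matrix (Fin n) (Fin n) S) (hA : TropCompound.Nonsingular A)
    (k : ℕ) (hk : k ≤ n) :
    TropCompound.MatrixCircGE
      (TropCompound.compound k A * TropCompound.compound k (TropCompound.quasiInverse A)) 1 := by
  intro I J
  obtain ⟨c, hc⟩ := TropCompound.exists_compound_mul_compound_adj_eq hS hA k I J
  refine ⟨_, ⟨c * Ring.inverse (TropCompound.det A) ^ k, rfl⟩, ?_⟩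
  have h : (TropCompound.compound k A * TropCompound.compound k (TropCompound.quasiInverse A)) I J =
      (TropCompound.compound k A * TropCompound.compound k (TropCompound.adj A)) I J *
        Ring.inverse (TropCompound.det A) ^ k := by
    rw [Matrix.mul_apply, Matrix.mul_apply, Finset.sum_mul]
    exact Finset.sum_congr rfl fun K _ => by
      rw [TropCompound.compound_quasiInverse, mul_assoc]
  rw [h, hc, add_mul, TropCompound.circ_mul, mul_right_comm, ← mul_pow,
    Ring.mul_inverse_cancel _ hA, one_pow, one_mul]
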